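/- **Theorem (non-negativity of weak solutions).** Let $\Omega\subset\mathbb R^n$ be a domain (nonempty, open, connected), $T>0$, $I=(0,T)$, $Q=I\times\Omega$. Put $H=L^2(\Omega)$ and $V=H^1(\Omega)$ with scalar product $(u,v)_V=\int_\Omega \nabla u\cdot\nabla v+uv\,dx$, let $V^*$ be the dual of $V$, with $V\subset H=H^*\subset V^*$, and let $$W=\{u\in L^2(I;V):\ \partial_t u\in L^2(I;V^*)\},$$ where $\partial_t u$ is the weak time derivative. Let $f\in L^1(I;H)+L^2(I;V^*)$ with $f\ge 0$ in the sense that $$\int_I\langle f(t),v(t)\rangle_{V^*,V}\,dt\ge 0\qquad\text{for all } v\in L^2(I;V)\cap C([0,T];H)\text{ with } v\ge 0 \text{ a.e. on } Q,$$ and let $u_0\in H$ with $u_0\ge 0$ a.e. on $\Omega$. Let $u\in W$ be a weak solution of $$\partial_t u-\Delta u=f\ \text{ on } Q,\qquad \partial_n u=0\ \text{ on } I\times\partial\Omega,\qquad u(0)=u_0,$$ that is, $u(0)=u_0$ in $H$ (the trace at $t=0$: $u(t)\to u_0$ in $H$ as $t\downarrow 0$ outside a null set of times), and for every $v\in V$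 and almost every $t\in I$ $$\langle \partial_t u(t),v\rangle_{V^*,V}+\int_\Omega\nabla u(t,x)\cdot\nabla v(x)\,dx=\langle f(t),v\rangle_{V^*,V}.$$ Then $u\ge 0$ a.e. on $Q$. -/

import Mathlib

open MeasureTheory Set Filter Topology
open scoped ContDiff

namespace NeumannHeat

noncomputable section

/-- `H = L²(Ω)`. -/
abbrev L2 {n : ℕ} (Ω : Set (EuclideanSpace ℝ (Fin n))) : Type :=
  Lp ℝ 2 (volume.restrict Ω)

/-- `L²(Ω; ℝⁿ)`. -/
abbrev L2Vec {n : ℕ} (Ω : Set (EuclideanSpace ℝ (Fin n))) : Type :=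
  Lp (EuclideanSpace ℝ (Fin n)) 2 (volume.restrict Ω)

/-- `g` is the weak gradient of `u` on `Ω`:
`∫_Ω u ∂_e φ = - ∫_Ω (g ⬝ e) φ` for every test function `φ ∈ C_c^∞(Ω)` and direction `e`. -/
def IsWeakGradient {n : ℕ} {Ω : Set (EuclideanSpace ℝ (Fin n))} (u : L2 Ω) (g : L2Vec Ω) : Prop :=
  ∀ φ : EuclideanSpace ℝ (Fin n) → ℝ, ContDiff ℝ ∞ φ → HasCompactSupport φ → tsupport φ ⊆ Ω →
    ∀ e : EuclideanSpace ℝ (Fin n),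
      ∫ x in Ω, u x * fderiv ℝ φ x e = - ∫ x in Ω, inner ℝ (g x) e * φ x

theorem integrable_mul_test {n : ℕ} {Ω : Set (EuclideanSpace ℝ (Fin n))} {w : EuclideanSpace ℝ (Fin n) → ℝ}
    (hw : MemLp w 2 (volume.restrict Ω)) {ψ : EuclideanSpace ℝ (Fin n) → ℝ}
    (hψ : Continuous ψ) (hc : HasCompactSupport ψ) :
    Integrable (fun x => w x * ψ x) (volume.restrict Ω) :=
  hw.integrable_mul (hψ.memLp_of_hasCompactSupport (p := 2) hc)

theorem continuous_fderiv_test {n : ℕ} {φ : EuclideanSpace ℝ (Fin n) → ℝ}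
    (hφ : ContDiff ℝ ∞ φ) (e : EuclideanSpace ℝ (Fin n)) :
    Continuous fun x => fderiv ℝ φ x e :=
  (hφ.continuous_fderiv (by simp)).clm_apply continuous_const

theorem hasCompactSupport_fderiv_test {n : ℕ} {φ : EuclideanSpace ℝ (Fin n) → ℝ}
    (hc : HasCompactSupport φ) (e : EuclideanSpace ℝ (Fin n)) :
    HasCompactSupport fun x => fderiv ℝ φ x e :=
  hc.fderiv_apply ℝ e

/-- `V = H¹(Ω)`, realized as the space of pairs `(u, ∇u)` with `u ∈ L²(Ω)` and weak gradient
`∇u ∈ L²(Ω; ℝⁿ)`; the inner product inherited from the `ℓ²`-product is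
`∫_Ω u v + ∫_Ω ∇u ⬝ ∇v`. -/
def H1 {n : ℕ} (Ω : Set (EuclideanSpace ℝ (Fin n))) :
    Submodule ℝ (WithLp 2 (L2 Ω × L2Vec Ω)) where
  carrier := {p | IsWeakGradient p.fst p.snd}
  zero_mem' := by
    intro φ _ _ _ e
    have h1 : (fun x => (0 : L2 Ω) x * fderiv ℝ φ x e) =ᵐ[volume.restrict Ω] 0 := by
      filter_upwards [Lp.coeFn_zero ℝ 2 (volume.restrict Ω)] with x hx
      rw [hx]; simp
    have h2 : (fun x => inner ℝ ((0 : L2Vec Ω) x) e * φ x) =ᵐ[volume.restrict Ω] 0 := by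
      filter_upwards [Lp.coeFn_zero (EuclideanSpace ℝ (Fin n)) 2 (volume.restrict Ω)] with x hx
      rw [hx]; simp
    exact (integral_congr_ae h1).trans (by rw [WithLp.zero_snd, integral_congr_ae h2]; simp)
  add_mem' := by
    intro p q hp hq φ hφ hc hs e
    have h1 : (fun x => (p.fst + q.fst : L2 Ω) x * fderiv ℝ φ x e) =ᵐ[volume.restrict Ω]
        fun x => p.fst x * fderiv ℝ φ x e + q.fst x * fderiv ℝ φ x e := by
      filter_upwards [Lp.coeFn_add p.fst q.fst] with x hx
      rw [hx, Pi.add_apply, add_mul]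
    have h2 : (fun x => inner ℝ ((p.snd + q.snd : L2Vec Ω) x) e * φ x) =ᵐ[volume.restrict Ω]
        fun x => inner ℝ (p.snd x) e * φ x + inner ℝ (q.snd x) e * φ x := by
      filter_upwards [Lp.coeFn_add p.snd q.snd] with x hx
      rw [hx, Pi.add_apply, inner_add_left, add_mul]
    have c1 := continuous_fderiv_test hφ e
    have c2 := hasCompactSupport_fderiv_test hc e
    rw [WithLp.add_fst, WithLp.add_snd, integral_congr_ae h1, integral_congr_ae h2,
      integral_add (integrable_mul_test (Lp.memLp p.fst) c1 c2)
        (integrable_mul_test (Lp.memLp q.fst) c1 c2),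
      integral_add (integrable_mul_test ((Lp.memLp p.snd).inner_const e) hφ.continuous hc)
        (integrable_mul_test ((Lp.memLp q.snd).inner_const e) hφ.continuous hc),
      hp φ hφ hc hs e, hq φ hφ hc hs e]
    ring
  smul_mem' := by
    intro c p hp φ hφ hc hs e
    have h1 : (fun x => (c • p.fst : L2 Ω) x * fderiv ℝ φ x e) =ᵐ[volume.restrict Ω]
        fun x => c * (p.fst x * fderiv ℝ φ x e) := by
      filter_upwards [Lp.coeFn_smul c p.fst] with x hx
      rw [hx, Pi.smul_apply, smul_eq_mul, mul_assoc]
    have h2 : (fun x => inner ℝ ((c • p.snd : L2Vec Ω) x) e * φ x) =ᵐ[volume.restrict Ω]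
        fun x => c * (inner ℝ (p.snd x) e * φ x) := by
      filter_upwards [Lp.coeFn_smul c p.snd] with x hx
      rw [hx, Pi.smul_apply, real_inner_smul_left, mul_assoc]
    rw [WithLp.smul_fst, WithLp.smul_snd, integral_congr_ae h1, integral_congr_ae h2,
      integral_const_mul, integral_const_mul, hp φ hφ hc hs e]
    ring

variable {n : ℕ} {Ω : Set (EuclideanSpace ℝ (Fin n))}

/-- The embedding `V → H`. -/
def toL2 : H1 Ω →L[ℝ] L2 Ω :=
  (WithLp.fstL 2 ℝ (L2 Ω) (L2Vec Ω)).comp (H1 Ω).subtypeL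

/-- The weak gradient `∇ : V → L²(Ω; ℝⁿ)`. -/
def grad : H1 Ω →L[ℝ] L2Vec Ω :=
  (WithLp.sndL 2 ℝ (L2 Ω) (L2Vec Ω)).comp (H1 Ω).subtypeL

/-- The embedding `H = H* → V*`, `⟨h, v⟩ = (h, v)_H`. -/
def dualOfL2 (h : L2 Ω) : StrongDual ℝ (H1 Ω) :=
  (innerSL ℝ h).comp toL2

/-- `w ∈ L²(I; V*)` is the weak time derivative of `u` on `I = (0, T)`:
`∫_I φ'(t) u(t) dt = - ∫_I φ(t) w(t) dt` in `V*` for all `φ ∈ C_c^∞(I)`, where `u(t) ∈ V` is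
identified with an element of `V*` through `V ⊂ H = H* ⊂ V*`. -/
structure IsWeakTimeDeriv (T : ℝ) (u : ℝ → H1 Ω) (w : ℝ → StrongDual ℝ (H1 Ω)) : Prop where
  memLp : MemLp w 2 (volume.restrict (Ioo 0 T))
  integral_eq : ∀ φ : ℝ → ℝ, ContDiff ℝ ∞ φ → HasCompactSupport φ → tsupport φ ⊆ Ioo 0 T →
    ∫ t in Ioo 0 T, deriv φ t • dualOfL2 (toL2 (u t)) = - ∫ t in Ioo 0 T, φ t • w t

/-- `f ∈ L¹(I; H) + L²(I; V*)`. -/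
def MemL1L2AddL2Dual (T : ℝ) (f : ℝ → StrongDual ℝ (H1 Ω)) : Prop :=
  ∃ (f₁ : ℝ → L2 Ω) (f₂ : ℝ → StrongDual ℝ (H1 Ω)),
    MemLp f₁ 1 (volume.restrict (Ioo 0 T)) ∧ MemLp f₂ 2 (volume.restrict (Ioo 0 T)) ∧
      ∀ᵐ t ∂(volume.restrict (Ioo 0 T)), f t = dualOfL2 (f₁ t) + f₂ t

/-- `v ∈ C([0, T]; H)`: up to a null set of times, `v` agrees with a function that is
continuous on `[0, T]` with values in `H`. -/
def HasContinuousRep (T : ℝ) (v : ℝ → H1 Ω) : Prop :=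
  ∃ v' : ℝ → L2 Ω, ContinuousOn v' (Icc 0 T) ∧
    ∀ᵐ t ∂(volume.restrict (Ioo 0 T)), toL2 (v t) = v' t

/-- `v ≥ 0`: for almost every `t ∈ I`, `v(t, x) ≥ 0` for almost every `x ∈ Ω`. -/
def IsNonneg (T : ℝ) (v : ℝ → H1 Ω) : Prop :=
  ∀ᵐ t ∂(volume.restrict (Ioo 0 T)), ∀ᵐ x ∂(volume.restrict Ω), 0 ≤ toL2 (v t) x

/-- `f ≥ 0` in the sense of duality: `⟨f, v⟩ = ∫_I ⟨f(t), v(t)⟩ dt ≥ 0` for all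
`v ∈ L²(I; V) ∩ C([0, T]; H)` with `v ≥ 0`. -/
def IsNonnegDual (T : ℝ) (f : ℝ → StrongDual ℝ (H1 Ω)) : Prop :=
  ∀ v : ℝ → H1 Ω, MemLp v 2 (volume.restrict (Ioo 0 T)) → HasContinuousRep T v →
    IsNonneg T v → 0 ≤ ∫ t in Ioo 0 T, f t (v t)

/-- `u(0) = u₀`: as `t ↓ 0` outside a null set of times, `u(t) → u₀` in `H`. If `u` agrees
almost everywhere with a function that is continuous on `[0, T]` with values in `H`, this says
that the value of that function at `0` is `u₀`. -/
def HasInitialValue (u : ℝ → H1 Ω) (u₀ : L2 Ω) : Prop :=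
  Tendsto (fun t => toL2 (u t)) (𝓝[>] 0 ⊓ ae volume) (𝓝 u₀)

/-- `u ∈ W` is a weak solution of `∂_t u - Δu = f` in `(0, T) × Ω`, `∂_n u = 0` on
`(0, T) × ∂Ω`, `u(0) = u₀`. -/
def IsWeakSolution (T : ℝ) (f : ℝ → StrongDual ℝ (H1 Ω)) (u₀ : L2 Ω) (u : ℝ → H1 Ω) : Prop :=
  MemLp u 2 (volume.restrict (Ioo 0 T)) ∧
  ∃ w : ℝ → StrongDual ℝ (H1 Ω), IsWeakTimeDeriv T u w ∧
    (∀ v : H1 Ω, ∀ᵐ t ∂(volume.restrict (Ioo 0 T)),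
      w t v + ∫ x in Ω, inner ℝ (grad (u t) x) (grad v x) = f t v) ∧
    HasInitialValue u u₀

end

end NeumannHeat

/-! Formally one tests the equation with the negative part of `u`: the squared norm of the negative
part decreases in time and vanishes at `t = 0`. Here the negative part is replaced by the C¹
function `softNeg`, which is 1-Lipschitz, nonincreasing and positive exactly on the negative
half-line. Its primitive gives `energy`, which is differentiable on L² and vanishes exactly at
nonnegative functions.

Time regularity comes from mollifying `u` in time. The mollification `m` is C¹ with values in V and
satisfies `(m', v) + (∇m, ∇v) ≥ 0` for every nonnegative `v ∈ V` (`mollified_inequality`). The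
choice `v = softNeg(m(t))`, admissible by the chain rule `IsWeakGradient.comp`, yields `d/dt
energy(m) = -(softNeg(m), m') ≤ (∇m, ∇softNeg(m)) ≤ 0`. Mollifications converge almost everywhere,
so `energy(u(t))` is nonincreasing off a null set (`energy_le_of_ae`). It tends to `energy u₀ = 0`
as `t ↓ 0`, hence is zero almost everywhere. -/

namespace NeumannHeat

/-! ### Mollification in finite dimension: almost everywhere and L¹ convergence. -/

section Mollification

open scoped Convolution
open ContinuousLinearMap

/-- Bump functions at the origin whose supports shrink to a point. -/
noncomputable def shrinkingBump (E : Type*) [NormedAddCommGroup E] [NormedSpace ℝ E] (i : ℕ) :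
    ContDiffBump (0 : E) where
  rIn := 1 / ((i : ℝ) + 1)
  rOut := 2 / ((i : ℝ) + 1)
  rIn_pos := by positivity
  rIn_lt_rOut := by gcongr; norm_num

theorem tendsto_rOut_shrinkingBump (E : Type*) [NormedAddCommGroup E] [NormedSpace ℝ E] :
    Tendsto (fun i => (shrinkingBump E i).rOut) atTop (𝓝 0) := by
  have := (tendsto_one_div_add_atTop_nhds_zero_nat (𝕜 := ℝ)).const_mul 2
  simpa [shrinkingBump, div_eq_mul_inv] using this

variable {E : Type*} [NormedAddCommGroup E] [NormedSpace ℝ E] [FiniteDimensional ℝ E]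
  [MeasurableSpace E] [BorelSpace E] [HasContDiffBump E] {μ : Measure E} [μ.IsAddHaarMeasure]

/-- The mollification of `g` at scale `2 / (i + 1)`. -/
noncomputable def mollify {F : Type*} [NormedAddCommGroup F] [NormedSpace ℝ F] (μ : Measure E)
    (g : E → F) (i : ℕ) : E → F :=
  (shrinkingBump E i).normed μ ⋆[lsmul ℝ ℝ, μ] g

theorem mollify_apply {F : Type*} [NormedAddCommGroup F] [NormedSpace ℝ F]
    (g : E → F) (i : ℕ) (x : E) :
    mollify μ g i x = ∫ y, (shrinkingBump E i).normed μ (x - y) • g y ∂μ := by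
  rw [mollify, convolution_eq_swap]; rfl

/-- Convergence at Lebesgue points: the ratio of outer to inner radius is always 2, so the kernels
are controlled by averages over balls. The vector-valued case serves for mollification in time. -/
theorem ae_tendsto_mollify {F : Type*} [NormedAddCommGroup F] [NormedSpace ℝ F] [CompleteSpace F]
    {g : E → F} (hg : LocallyIntegrable g μ) :
    ∀ᵐ x ∂μ, Tendsto (fun i => mollify μ g i x) atTop (𝓝 (g x)) := by
  refine ContDiffBump.ae_convolution_tendsto_right_of_locallyIntegrable (K := 2)
    (tendsto_rOut_shrinkingBump E) (Eventually.of_forall fun i => ?_) hg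
  simp [shrinkingBump, div_eq_mul_inv]

theorem integrable_mollify {g : E → ℝ} (hg : Integrable g μ) (i : ℕ) :
    Integrable (mollify μ g i) μ :=
  ((shrinkingBump E i).integrable_normed (μ := μ)).integrable_convolution _ hg

theorem integral_mollify {g : E → ℝ} (hg : Integrable g μ) (i : ℕ) :
    ∫ x, mollify μ g i x ∂μ = ∫ x, g x ∂μ := by
  have h := integral_convolution (μ := μ) (ν := μ) (lsmul ℝ ℝ : ℝ →L[ℝ] ℝ →L[ℝ] ℝ)
    ((shrinkingBump E i).integrable_normed (μ := μ)) hg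
  rwa [(shrinkingBump E i).integral_normed, lsmul_apply, one_smul] at h

theorem abs_mollify_le (g : E → ℝ) (i : ℕ) (x : E) :
    |mollify μ g i x| ≤ mollify μ (fun y => |g y|) i x := by
  rw [mollify_apply, mollify_apply]
  refine abs_integral_le_integral_abs.trans_eq (integral_congr_ae (ae_of_all _ fun y => ?_))
  simp [abs_mul, abs_of_nonneg ((shrinkingBump E i).nonneg_normed (x - y))]

/-- Mollification converges in `L¹`. -/
theorem tendsto_integral_abs_mollify_sub {g : E → ℝ} (hg : Integrable g μ) :
    Tendsto (fun i => ∫ x, |mollify μ g i x - g x| ∂μ) atTop (𝓝 0) := by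
  -- With `M` the mollification of `|g|`, the error is at most `min |m - g| (2|g|) + (|g| - M)⁺ + (M
  -- - |g|)`. The first two terms are dominated and tend to 0 almost everywhere; the last has
  -- integral 0.
  have hga : Integrable (fun x => |g x|) μ := hg.abs
  have c1 := ae_tendsto_mollify hg.locallyIntegrable
  have c2 := ae_tendsto_mollify hga.locallyIntegrable
  have i1 : ∀ i, Integrable (fun x => min |mollify μ g i x - g x| (2 * |g x|)) μ := fun i =>
    ((integrable_mollify hg i).sub hg).abs.inf (hga.const_mul 2)
  have i2 : ∀ i, Integrable (fun x => max (|g x| - mollify μ (fun y => |g y|) i x) 0) μ := fun i =>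
    (hga.sub (integrable_mollify hga i)).pos_part
  have t1 : Tendsto (fun i => ∫ x, min |mollify μ g i x - g x| (2 * |g x|) ∂μ) atTop (𝓝 0) := by
    have h0 : ∫ _ : E, (0 : ℝ) ∂μ = 0 := integral_zero E ℝ
    rw [← congrArg 𝓝 h0]
    refine tendsto_integral_of_dominated_convergence (fun x => 2 * |g x|) (fun i => (i1 i).1)
      (hga.const_mul 2) (fun i => ae_of_all _ fun x => ?_) ?_
    · rw [Real.norm_of_nonneg (le_min (abs_nonneg _) (by positivity))]
      exact min_le_right _ _
    · filter_upwards [c1] with x hx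
      have h := ((hx.sub_const (g x)).abs).min (tendsto_const_nhds (x := 2 * |g x|))
      simpa using h
  have t2 : Tendsto (fun i => ∫ x, max (|g x| - mollify μ (fun y => |g y|) i x) 0 ∂μ) atTop
      (𝓝 0) := by
    have h0 : ∫ _ : E, (0 : ℝ) ∂μ = 0 := integral_zero E ℝ
    rw [← congrArg 𝓝 h0]
    refine tendsto_integral_of_dominated_convergence (fun x => |g x|) (fun i => (i2 i).1)
      hga (fun i => ae_of_all _ fun x => ?_) ?_
    · rw [Real.norm_of_nonneg (le_max_right _ _)]
      have := (abs_nonneg _).trans (abs_mollify_le (μ := μ) g i x)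
      exact max_le (by linarith) (abs_nonneg _)
    · filter_upwards [c2] with x hx
      have h := (hx.const_sub |g x|).max (tendsto_const_nhds (x := (0 : ℝ)))
      simpa using h
  refine squeeze_zero (fun i => integral_nonneg fun x => abs_nonneg _) (fun i => ?_)
    (by simpa using t1.add t2)
  have i3 := (integrable_mollify hga i).sub hga
  have e3 : ∫ x, (mollify μ (fun y => |g y|) i x - |g x|) ∂μ = 0 := by
    rw [integral_sub (integrable_mollify hga i) hga, integral_mollify hga, sub_self]
  calc ∫ x, |mollify μ g i x - g x| ∂μ
      ≤ ∫ x, (min |mollify μ g i x - g x| (2 * |g x|)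
        + max (|g x| - mollify μ (fun y => |g y|) i x) 0
        + (mollify μ (fun y => |g y|) i x - |g x|)) ∂μ := by
        refine integral_mono ((integrable_mollify hg i).sub hg).abs
          (((i1 i).add (i2 i)).add i3) fun x => ?_
        have h1 := abs_mollify_le (μ := μ) g i x
        have h2 := abs_sub (mollify μ g i x) (g x)
        dsimp only
        rcases le_total |mollify μ g i x - g x| (2 * |g x|) with h | h <;>
          rcases le_total (|g x| - mollify μ (fun y => |g y|) i x) 0 with h' | h' <;>
          simp only [h, h', min_eq_left, min_eq_right, max_eq_left, max_eq_right] <;> linarith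
    _ = _ := by
        have h := integral_add ((i1 i).add (i2 i)) i3
        have h' := integral_add (i1 i) (i2 i)
        simp only [Pi.add_apply, Pi.sub_apply] at h h'
        rw [h, h', e3, add_zero]

theorem contDiff_mollify {F : Type*} [NormedAddCommGroup F] [NormedSpace ℝ F]
    {g : E → F} (hg : LocallyIntegrable g μ) (i : ℕ) : ContDiff ℝ 1 (mollify μ g i) :=
  (shrinkingBump E i).hasCompactSupport_normed.contDiff_convolution_left _ (n := 1)
    (shrinkingBump E i).contDiff_normed hg

theorem fderiv_mollify_apply {F : Type*} [NormedAddCommGroup F] [NormedSpace ℝ F]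
    {g : E → F} (hg : LocallyIntegrable g μ) (i : ℕ) (x e : E) :
    fderiv ℝ (mollify μ g i) x e =
      ∫ y, fderiv ℝ ((shrinkingBump E i).normed μ) (x - y) e • g y ∂μ := by
  have hc : HasCompactSupport ((shrinkingBump E i).normed μ) :=
    (shrinkingBump E i).hasCompactSupport_normed
  have hd : ContDiff ℝ 1 ((shrinkingBump E i).normed μ) :=
    (shrinkingBump E i).contDiff_normed (n := 1)
  have h1 : mollify μ g i = g ⋆[(lsmul ℝ ℝ).flip, μ] (shrinkingBump E i).normed μ :=
    (convolution_flip _).symm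
  rw [h1, (hc.hasFDerivAt_convolution_right _ hg hd x).fderiv,
    convolution_precompR_apply _ hg (hc.fderiv ℝ) (hd.continuous_fderiv one_ne_zero)]
  rfl

theorem tsupport_normed_const_sub_subset (i : ℕ) (x : E) :
    tsupport (fun y => (shrinkingBump E i).normed μ (x - y)) ⊆
      Metric.closedBall x (shrinkingBump E i).rOut := by
  refine closure_minimal (fun y hy => ?_) Metric.isClosed_closedBall
  have h : x - y ∈ Function.support ((shrinkingBump E i).normed μ) := hy
  rw [ContDiffBump.support_normed_eq, mem_ball_zero_iff] at h
  rw [mem_closedBall_iff_norm']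
  exact h.le

end Mollification

/-! ### Weak gradients: the chain rule and completeness of H¹. -/

variable {n : ℕ} {Ω : Set (EuclideanSpace ℝ (Fin n))}

theorem tendsto_integral_sub_of_le {α : Type*} [MeasurableSpace α] {μ : Measure α}
    {a a' b : ℕ → α → ℝ} {c : ℝ} (ha : ∀ i, Integrable (a i) μ) (ha' : ∀ i, Integrable (a' i) μ)
    (hb : ∀ i, Integrable (b i) μ) (hab : ∀ i x, |a i x - a' i x| ≤ c * |b i x|)
    (hlim : Tendsto (fun i => ∫ x, |b i x| ∂μ) atTop (𝓝 0)) :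
    Tendsto (fun i => ∫ x, a i x ∂μ - ∫ x, a' i x ∂μ) atTop (𝓝 0) := by
  refine squeeze_zero_norm (a := fun i => c * ∫ x, |b i x| ∂μ) (fun i => ?_)
    (by simpa using hlim.const_mul c)
  rw [← integral_sub (ha i) (ha' i), ← integral_const_mul]
  exact norm_integral_le_of_norm_le ((hb i).abs.const_mul c) (ae_of_all _ fun x => hab i x)

theorem abs_sub_le_of_abs_deriv_le {F : ℝ → ℝ} (hF : Differentiable ℝ F) {C : ℝ}
    (hC : ∀ x, |deriv F x| ≤ C) (x y : ℝ) : |F x - F y| ≤ C * |x - y| :=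
  convex_univ.norm_image_sub_le_of_norm_deriv_le (fun z _ => hF z) (fun z _ => hC z)
    (mem_univ y) (mem_univ x)

/-- Mollification commutes with weak differentiation, at a positive distance from `Ωᶜ`. -/
theorem IsWeakGradient.fderiv_mollify {u : L2 Ω} {g : L2Vec Ω} (h : IsWeakGradient u g)
    {K : Set (EuclideanSpace ℝ (Fin n))} (hK : IsCompact K) (hKΩ : K ⊆ Ω)
    (hu : LocallyIntegrable (K.indicator u)) (i : ℕ)
    {x : EuclideanSpace ℝ (Fin n)} (hx : Metric.closedBall x (shrinkingBump (EuclideanSpace ℝ (Fin n)) i).rOut ⊆ K)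
    (e : EuclideanSpace ℝ (Fin n)) :
    fderiv ℝ (mollify volume (K.indicator u) i) x e =
      mollify volume (K.indicator fun y => inner ℝ (g y) e) i x := by
  set ρ : EuclideanSpace ℝ (Fin n) → ℝ := (shrinkingBump (EuclideanSpace ℝ (Fin n)) i).normed volume with hρ
  have hd : ContDiff ℝ ∞ ρ := (shrinkingBump (EuclideanSpace ℝ (Fin n)) i).contDiff_normed
  have hts : tsupport (fun y => ρ (x - y)) ⊆ K :=
    (tsupport_normed_const_sub_subset i x).trans hx
  have hψ : ContDiff ℝ ∞ fun y => ρ (x - y) := hd.comp (contDiff_const.sub contDiff_id)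
  have hψ' : ∀ y, fderiv ℝ (fun y => ρ (x - y)) y e = - fderiv ℝ ρ (x - y) e := fun y => by
    have h1 : HasFDerivAt (fun y => x - y) (-ContinuousLinearMap.id ℝ _) y :=
      (hasFDerivAt_id y).const_sub x
    have h2 := ((hd.differentiable (by simp)) (x - y)).hasFDerivAt.comp y h1
    rw [show fderiv ℝ (fun y => ρ (x - y)) y = _ from h2.fderiv]
    simp
  -- The kernel centred at `x` is itself an admissible test function; differentiating in `y` instead
  -- of `x` produces the sign.
  have key := h (fun y => ρ (x - y)) hψ (HasCompactSupport.of_support_subset_isCompact hK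
    (subset_closure.trans hts)) (hts.trans hKΩ) e
  have z1 : ∀ y ∉ K, ρ (x - y) = 0 := fun y hy =>
    image_eq_zero_of_notMem_tsupport (f := fun y => ρ (x - y)) fun h' => hy (hts h')
  have z2 : ∀ y ∉ K, fderiv ℝ ρ (x - y) e = 0 := fun y hy => by
    rw [← neg_eq_zero, ← hψ', image_eq_zero_of_notMem_tsupport (f := fderiv ℝ fun y => ρ (x - y))
      fun h' => hy (hts (tsupport_fderiv_subset ℝ h'))]
    rfl
  rw [fderiv_mollify_apply hu, mollify_apply,
    ← setIntegral_eq_integral_of_forall_compl_eq_zero (s := Ω)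
      (f := fun y => fderiv ℝ ρ (x - y) e • K.indicator u y)
      (fun y hy => by rw [z2 y fun h' => hy (hKΩ h'), zero_smul]),
    ← setIntegral_eq_integral_of_forall_compl_eq_zero (s := Ω)
      (f := fun y => ρ (x - y) • K.indicator (fun y => inner ℝ (g y) e) y)
      (fun y hy => by rw [z1 y fun h' => hy (hKΩ h'), zero_smul])]
  rw [eq_comm, ← neg_inj, eq_comm]
  calc _ = ∫ y in Ω, u y * fderiv ℝ (fun y => ρ (x - y)) y e := by
        rw [← integral_neg]
        refine integral_congr_ae (ae_of_all _ fun y => ?_)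
        by_cases hy : y ∈ K
        · simp only [indicator_of_mem hy, hψ', smul_eq_mul]; ring
        · simp only [indicator_of_notMem hy, hψ', z2 y hy]; simp
    _ = _ := by
        rw [key]
        congr 1
        refine integral_congr_ae (ae_of_all _ fun y => ?_)
        by_cases hy : y ∈ K
        · simp only [indicator_of_mem hy, smul_eq_mul]; ring
        · simp only [indicator_of_notMem hy, z1 y hy]; simp

theorem integrable_indicator_of_memLp {w : EuclideanSpace ℝ (Fin n) → ℝ}
    (hw : MemLp w 2 (volume.restrict Ω)) {K : Set (EuclideanSpace ℝ (Fin n))} (hK : IsCompact K)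
    (hKΩ : K ⊆ Ω) : Integrable (K.indicator w) := by
  rw [integrable_indicator_iff hK.measurableSet, IntegrableOn]
  have h := hw.restrict K
  rw [Measure.restrict_restrict hK.measurableSet, inter_eq_left.2 hKΩ] at h
  have : IsFiniteMeasure (volume.restrict K) := ⟨by simpa using hK.measure_lt_top⟩
  exact h.integrable one_le_two

/-- The chain rule for weak gradients. -/
theorem IsWeakGradient.comp {u : L2 Ω} {g : L2Vec Ω} (h : IsWeakGradient u g) (hΩ : IsOpen Ω)
    {F : ℝ → ℝ} (hF : ContDiff ℝ 1 F) {C : ℝ} (hC : ∀ x, |deriv F x| ≤ C)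
    {v : L2 Ω} {k : L2Vec Ω} (hv : ∀ᵐ x ∂(volume.restrict Ω), v x = F (u x))
    (hk : ∀ᵐ x ∂(volume.restrict Ω), k x = deriv F (u x) • g x) : IsWeakGradient v k := by
  intro φ hφ hc hs e
  -- A compact collar around the support of `φ` inside `Ω`. Truncation to it makes `u` and `g`
  -- integrable on the whole space, and mollification at scale below `δ` does not see the truncation
  -- on the support of `φ`.
  obtain ⟨δ, hδ, hδΩ⟩ := hc.isCompact.exists_cthickening_subset_open hΩ hs
  set K := Metric.cthickening δ (tsupport φ) with hKdef
  have hK : IsCompact K := hc.isCompact.cthickening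
  have hsK : tsupport φ ⊆ K := Metric.self_subset_cthickening _
  set U : EuclideanSpace ℝ (Fin n) → ℝ := K.indicator u with hU
  set G : EuclideanSpace ℝ (Fin n) → ℝ := K.indicator fun y => inner ℝ (g y) e with hG
  have iU : Integrable U := integrable_indicator_of_memLp (Lp.memLp u) hK hδΩ
  have iG : Integrable G := integrable_indicator_of_memLp ((Lp.memLp g).inner_const e) hK hδΩ
  have cF' : Continuous (deriv F) := hF.continuous_deriv le_rfl
  have dF : Differentiable ℝ F := hF.differentiable one_ne_zero
  have lip := abs_sub_le_of_abs_deriv_le dF hC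
  have c1 := continuous_fderiv_test hφ e
  have k1 := hasCompactSupport_fderiv_test hc e
  obtain ⟨A, hA⟩ := hc.exists_bound_of_continuous hφ.continuous
  obtain ⟨B, hB⟩ := k1.exists_bound_of_continuous c1
  have hC0 : 0 ≤ C := (abs_nonneg _).trans (hC 0)
  set m := mollify volume U with hm
  set q := mollify volume G with hq
  have cm : ∀ i, ContDiff ℝ 1 (m i) := contDiff_mollify iU.locallyIntegrable
  have iq : ∀ i, Integrable (q i) := integrable_mollify iG
  have im : ∀ i, Integrable (m i) := integrable_mollify iU
  have iFU : Integrable fun x => F (U x) * fderiv ℝ φ x e := by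
    have j1 : Integrable fun x => F 0 * fderiv ℝ φ x e :=
      (c1.integrable_of_hasCompactSupport k1).const_mul _
    have j2 : Integrable fun x => (F (U x) - F 0) * fderiv ℝ φ x e := by
      refine Integrable.mul_bdd (c := B) (Integrable.mono' (iU.abs.const_mul C) ?_ ?_)
        c1.aestronglyMeasurable (ae_of_all _ hB)
      · exact (hF.continuous.comp_aestronglyMeasurable iU.1).sub aestronglyMeasurable_const
      · exact ae_of_all _ fun x => by simpa using lip (U x) 0
    refine (j1.add j2).congr (ae_of_all _ fun x => ?_)
    simp only [Pi.add_apply]; ring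
  have iFm : ∀ i, Integrable fun x => F (m i x) * fderiv ℝ φ x e := fun i =>
    ((hF.continuous.comp (cm i).continuous).mul c1).integrable_of_hasCompactSupport k1.mul_left
  have t1 : Tendsto (fun i => ∫ x, F (m i x) * fderiv ℝ φ x e) atTop
      (𝓝 (∫ x, F (U x) * fderiv ℝ φ x e)) := by
    rw [← tendsto_sub_nhds_zero_iff]
    refine tendsto_integral_sub_of_le (a' := fun _ x => F (U x) * fderiv ℝ φ x e)
      (b := fun i x => m i x - U x) (c := C * B) iFm (fun _ => iFU)
      (fun i => (im i).sub iU) (fun i x => ?_) (tendsto_integral_abs_mollify_sub iU)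
    rw [← sub_mul, abs_mul, mul_right_comm]
    exact mul_le_mul (lip _ _) (hB x) (abs_nonneg _) (by positivity)
  have bdd : ∀ {w p : EuclideanSpace ℝ (Fin n) → ℝ}, AEStronglyMeasurable w → Integrable p →
      Integrable fun x => deriv F (w x) * p x * φ x := fun hw hp =>
    ((hp.bdd_mul (cF'.comp_aestronglyMeasurable hw) (ae_of_all _ fun x => hC _)).mul_bdd
      hφ.continuous.aestronglyMeasurable (ae_of_all _ hA))
  have t2 : Tendsto (fun i => ∫ x, deriv F (m i x) * q i x * φ x) atTop
      (𝓝 (∫ x, deriv F (U x) * G x * φ x)) := by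
    -- Since `deriv F` is only bounded and continuous, the two factors are treated in turn:
    -- dominated convergence with `G` fixed, then L¹ convergence of `q i` to `G`.
    have s1 : Tendsto (fun i => ∫ x, deriv F (m i x) * G x * φ x) atTop
        (𝓝 (∫ x, deriv F (U x) * G x * φ x)) := by
      refine tendsto_integral_of_dominated_convergence (fun x => C * |G x| * A)
        (fun i => (bdd (im i).1 iG).1) ((iG.abs.const_mul C).mul_const A)
        (fun i => ae_of_all _ fun x => ?_) ?_
      · rw [norm_mul, norm_mul]
        exact mul_le_mul (mul_le_mul_of_nonneg_right (hC _) (abs_nonneg _)) (hA x) (norm_nonneg _)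
          (by positivity)
      · filter_upwards [ae_tendsto_mollify iU.locallyIntegrable] with x hx
        exact ((cF'.tendsto _).comp hx).mul_const _ |>.mul_const _
    have s2 := tendsto_integral_sub_of_le (a := fun i x => deriv F (m i x) * q i x * φ x)
      (a' := fun i x => deriv F (m i x) * G x * φ x)
      (b := fun i x => q i x - G x) (c := C * A) (fun i => bdd (im i).1 (iq i))
      (fun i => bdd (im i).1 iG) (fun i => (iq i).sub iG) (fun i x => by
        rw [← sub_mul, ← mul_sub, abs_mul, abs_mul, mul_right_comm C A]
        exact mul_le_mul (mul_le_mul_of_nonneg_right (hC _) (abs_nonneg _)) (hA x) (abs_nonneg _)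
          (by positivity)) (tendsto_integral_abs_mollify_sub iG)
    simpa using s2.add s1
  -- At small scales this is classical integration by parts; `q i` has to be the derivative of `m i`
  -- only on the support of `φ`.
  have ev : ∀ᶠ i in atTop, ∫ x, F (m i x) * fderiv ℝ φ x e =
      - ∫ x, deriv F (m i x) * q i x * φ x := by
    filter_upwards [(tendsto_rOut_shrinkingBump (EuclideanSpace ℝ (Fin n))).eventually_lt_const hδ]
      with i hi
    have hd : ∀ x, fderiv ℝ (fun x => F (m i x)) x e * φ x = deriv F (m i x) * q i x * φ x := by
      intro x
      by_cases hx : x ∈ tsupport φ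
      · have h1 : fderiv ℝ (m i) x e = q i x :=
          h.fderiv_mollify hK hδΩ iU.locallyIntegrable i
            ((Metric.closedBall_subset_closedBall hi.le).trans
              (Metric.closedBall_subset_cthickening hx δ)) e
        have h2 := ((dF (m i x)).hasDerivAt.comp_hasFDerivAt x
          ((cm i).differentiable one_ne_zero x).hasFDerivAt).fderiv
        have h3 : fderiv ℝ (fun x => F (m i x)) x = deriv F (m i x) • fderiv ℝ (m i) x := h2
        rw [h3, ← h1]; rfl
      · rw [image_eq_zero_of_notMem_tsupport hx, mul_zero, mul_zero]
    rw [← integral_congr_ae (ae_of_all _ hd)]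
    refine integral_mul_fderiv_eq_neg_fderiv_mul_of_integrable ?_ (iFm i) ?_
      (fun x _ => (dF _).comp x ((cm i).differentiable one_ne_zero x))
      (fun x _ => hφ.differentiable (by simp) x)
    · exact (bdd (im i).1 (iq i)).congr (ae_of_all _ fun x => (hd x).symm)
    · exact ((hF.continuous.comp (cm i).continuous).mul
        hφ.continuous).integrable_of_hasCompactSupport hc.mul_left
  have lim := tendsto_nhds_unique (t1.congr' ev) t2.neg
  have z1 : ∀ x ∉ K, φ x = 0 := fun x hx =>
    image_eq_zero_of_notMem_tsupport fun h' => hx (hsK h')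
  have z2 : ∀ x ∉ K, fderiv ℝ φ x e = 0 := fun x hx => by
    rw [image_eq_zero_of_notMem_tsupport (f := fderiv ℝ φ)
      fun h' => hx (hsK (tsupport_fderiv_subset ℝ h'))]
    rfl
  rw [← setIntegral_eq_integral_of_forall_compl_eq_zero (s := Ω)
      (f := fun x => F (U x) * fderiv ℝ φ x e)
      (fun y hy => by rw [z2 y fun h' => hy (hδΩ h'), mul_zero]),
    ← setIntegral_eq_integral_of_forall_compl_eq_zero (s := Ω)
      (f := fun x => deriv F (U x) * G x * φ x)
      (fun y hy => by rw [z1 y fun h' => hy (hδΩ h'), mul_zero])] at lim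
  refine Eq.trans (integral_congr_ae ?_) (lim.trans (congrArg Neg.neg (integral_congr_ae ?_)))
  · filter_upwards [hv] with x hx
    by_cases hxK : x ∈ K
    · rw [hx, hU, indicator_of_mem hxK]
    · rw [z2 x hxK, mul_zero, mul_zero]
  · filter_upwards [hk] with x hx
    by_cases hxK : x ∈ K
    · rw [hx, hU, hG, indicator_of_mem hxK, indicator_of_mem hxK, real_inner_smul_left]
    · rw [z1 x hxK, mul_zero, mul_zero]

theorem continuous_integral_inner {α E : Type*} [MeasurableSpace α] {μ : Measure α}
    [NormedAddCommGroup E] [InnerProductSpace ℝ E] {ψ : α → E} (hψ : MemLp ψ 2 μ) :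
    Continuous fun p : Lp E 2 μ => ∫ x, inner ℝ (p x) (ψ x) ∂μ := by
  have h : (fun p : Lp E 2 μ => ∫ x, inner ℝ (p x) (ψ x) ∂μ) = fun p => inner ℝ p (hψ.toLp ψ) := by
    funext p
    rw [L2.inner_def]
    refine integral_congr_ae ?_
    filter_upwards [hψ.coeFn_toLp] with x hx
    rw [hx]
  rw [h]
  fun_prop

/-- Each test identity equates two continuous functionals of the pair `(u, g)`. The resulting
completeness is what gives meaning to Bochner integrals in V, hence to mollification in time. -/
theorem isClosed_H1 : IsClosed (H1 Ω : Set (WithLp 2 (L2 Ω × L2Vec Ω))) := by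
  have h : (H1 Ω : Set (WithLp 2 (L2 Ω × L2Vec Ω))) = {p | IsWeakGradient p.fst p.snd} := rfl
  rw [h]
  simp only [IsWeakGradient, ofPred_forall]
  refine isClosed_iInter fun φ => isClosed_iInter fun hφ => isClosed_iInter fun hc =>
    isClosed_iInter fun _ => isClosed_iInter fun e => ?_
  have m1 : MemLp (fun x => fderiv ℝ φ x e) 2 (volume.restrict Ω) :=
    (continuous_fderiv_test hφ e).memLp_of_hasCompactSupport (hasCompactSupport_fderiv_test hc e)
  have m2 : MemLp (fun x => φ x • e) 2 (volume.restrict Ω) :=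
    (hφ.continuous.smul continuous_const).memLp_of_hasCompactSupport hc.smul_right
  have c1 := (continuous_integral_inner m1).comp (WithLp.fstL 2 ℝ (L2 Ω) (L2Vec Ω)).continuous
  have c2 := (continuous_integral_inner m2).comp (WithLp.sndL 2 ℝ (L2 Ω) (L2Vec Ω)).continuous
  have e1 : ∀ x (p : WithLp 2 (L2 Ω × L2Vec Ω)),
      p.fst x * fderiv ℝ φ x e = inner ℝ (p.fst x) (fderiv ℝ φ x e) := fun x p => by
    simp [mul_comm]
  have e2 : ∀ x (p : WithLp 2 (L2 Ω × L2Vec Ω)),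
      inner ℝ (p.snd x) e * φ x = inner ℝ (p.snd x) (φ x • e) := fun x p => by
    rw [real_inner_smul_right, mul_comm]
  simp only [e1, e2]
  exact isClosed_eq c1 c2.neg

instance : CompleteSpace (H1 Ω) := isClosed_H1.completeSpace_coe

/-! ### The scalar functions: a C¹ negative part and its primitive. -/

section Primitive

theorem hasDerivAt_integral_left {c : ℝ → ℝ} (hc : Continuous c) (b x : ℝ) :
    HasDerivAt (fun x => ∫ s in x..b, c s) (-c x) x :=
  intervalIntegral.integral_hasDerivAt_left (hc.intervalIntegrable _ _)
    (hc.stronglyMeasurableAtFilter _ _) hc.continuousAt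

theorem integral_left_eq_zero {c : ℝ → ℝ} (h0 : ∀ s, 0 ≤ s → c s = 0) {x : ℝ} (hx : 0 ≤ x) :
    ∫ s in x..0, c s = 0 := by
  rw [intervalIntegral.integral_symm, intervalIntegral.integral_congr (g := fun _ => 0)]
  · simp
  · intro s hs
    rw [uIcc_of_le hx] at hs
    exact h0 s hs.1

theorem integral_left_pos {c : ℝ → ℝ} (hc : Continuous c) (h1 : ∀ s, s < 0 → 0 < c s) {x : ℝ}
    (hx : x < 0) : 0 < ∫ s in x..0, c s :=
  intervalIntegral.intervalIntegral_pos_of_pos_on (hc.intervalIntegrable _ _)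
    (fun s hs => h1 s hs.2) hx

end Primitive

/-- A bounded continuous function that is positive exactly on the negative half-line. -/
def negSlope (s : ℝ) : ℝ := min (max (-s) 0) 1

theorem continuous_negSlope : Continuous negSlope := by unfold negSlope; fun_prop

theorem negSlope_nonneg (s : ℝ) : 0 ≤ negSlope s := le_min (le_max_right _ _) zero_le_one

theorem negSlope_le_one (s : ℝ) : negSlope s ≤ 1 := min_le_right _ _

theorem negSlope_of_nonneg (s : ℝ) (hs : 0 ≤ s) : negSlope s = 0 := by
  simp [negSlope, max_eq_right (neg_nonpos.2 hs)]

theorem negSlope_pos (s : ℝ) (hs : s < 0) : 0 < negSlope s :=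
  lt_min (lt_max_of_lt_left (neg_pos.2 hs)) one_pos

/-- A `C¹` substitute for the negative part. -/
noncomputable def softNeg (x : ℝ) : ℝ := ∫ s in x..0, negSlope s

theorem hasDerivAt_softNeg (x : ℝ) : HasDerivAt softNeg (-negSlope x) x :=
  hasDerivAt_integral_left continuous_negSlope 0 x

theorem deriv_softNeg : deriv softNeg = fun x => -negSlope x :=
  funext fun x => (hasDerivAt_softNeg x).deriv

theorem contDiff_softNeg : ContDiff ℝ 1 softNeg := by
  rw [contDiff_one_iff_deriv, deriv_softNeg]
  exact ⟨fun x => (hasDerivAt_softNeg x).differentiableAt, continuous_negSlope.neg⟩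

theorem abs_deriv_softNeg_le (x : ℝ) : |deriv softNeg x| ≤ 1 := by
  rw [deriv_softNeg, abs_neg, abs_of_nonneg (negSlope_nonneg x)]
  exact negSlope_le_one x

theorem softNeg_of_nonneg (x : ℝ) (hx : 0 ≤ x) : softNeg x = 0 :=
  integral_left_eq_zero negSlope_of_nonneg hx

theorem softNeg_zero : softNeg 0 = 0 := softNeg_of_nonneg 0 le_rfl

theorem softNeg_pos (x : ℝ) (hx : x < 0) : 0 < softNeg x :=
  integral_left_pos continuous_negSlope negSlope_pos hx

theorem softNeg_nonneg (x : ℝ) : 0 ≤ softNeg x :=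
  (lt_or_ge x 0).elim (fun h => (softNeg_pos x h).le) fun h => (softNeg_of_nonneg x h).ge

theorem abs_softNeg_sub_le (x y : ℝ) : |softNeg x - softNeg y| ≤ |x - y| := by
  simpa using abs_sub_le_of_abs_deriv_le (contDiff_softNeg.differentiable one_ne_zero)
    abs_deriv_softNeg_le x y

theorem lipschitzWith_softNeg : LipschitzWith 1 softNeg :=
  LipschitzWith.of_dist_le_mul fun x y => by simpa [Real.dist_eq] using abs_softNeg_sub_le x y

/-- The convex primitive of `-softNeg`. -/
noncomputable def softNegEnergy (x : ℝ) : ℝ := ∫ s in x..0, softNeg s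

theorem hasDerivAt_softNegEnergy (x : ℝ) : HasDerivAt softNegEnergy (-softNeg x) x :=
  hasDerivAt_integral_left contDiff_softNeg.continuous 0 x

theorem continuous_softNegEnergy : Continuous softNegEnergy :=
  continuous_iff_continuousAt.2 fun x => (hasDerivAt_softNegEnergy x).continuousAt

theorem softNegEnergy_of_nonneg (x : ℝ) (hx : 0 ≤ x) : softNegEnergy x = 0 :=
  integral_left_eq_zero softNeg_of_nonneg hx

theorem softNegEnergy_pos (x : ℝ) (hx : x < 0) : 0 < softNegEnergy x :=
  integral_left_pos contDiff_softNeg.continuous softNeg_pos hx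

theorem softNegEnergy_nonneg (x : ℝ) : 0 ≤ softNegEnergy x :=
  (lt_or_ge x 0).elim (fun h => (softNegEnergy_pos x h).le) fun h =>
    (softNegEnergy_of_nonneg x h).ge

/-- The function `z ↦ softNegEnergy z + softNeg x * z` has derivative `softNeg x - softNeg z`, at
most `|y - x|` in size between `x` and `y`. The constant is global, so the bound can be integrated.
-/
theorem abs_softNegEnergy_taylor_le (x y : ℝ) :
    |softNegEnergy y - softNegEnergy x + softNeg x * (y - x)| ≤ (y - x) ^ 2 := by
  have hd : ∀ z, HasDerivAt (fun z => softNegEnergy z + softNeg x * z) (softNeg x - softNeg z) z :=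
    fun z => ((hasDerivAt_softNegEnergy z).add
      ((hasDerivAt_id z).const_mul (softNeg x))).congr_deriv (by ring)
  have h := (convex_uIcc x y).norm_image_sub_le_of_norm_hasDerivWithin_le (C := |y - x|)
    (fun z _ => (hd z).hasDerivWithinAt) (fun z hz => ?_) left_mem_uIcc right_mem_uIcc
  · rw [Real.norm_eq_abs, Real.norm_eq_abs, ← sq, sq_abs] at h
    refine le_of_eq_of_le (congrArg _ ?_) h
    ring
  · rw [Real.norm_eq_abs, abs_sub_comm]
    exact (abs_softNeg_sub_le z x).trans (abs_sub_left_of_mem_uIcc hz)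

theorem abs_softNegEnergy_le (x : ℝ) : |softNegEnergy x| ≤ x ^ 2 := by
  simpa [softNeg_zero, softNegEnergy_of_nonneg 0 le_rfl] using abs_softNegEnergy_taylor_le 0 x

/-! ### The energy functional on L² and its derivative. -/

section Energy

variable {α : Type*} [MeasurableSpace α] {μ : Measure α}

/-- The superposition operator of `softNeg` on `L²`. -/
noncomputable def softNegL2 (p : Lp ℝ 2 μ) : Lp ℝ 2 μ :=
  lipschitzWith_softNeg.compLp softNeg_zero p

theorem coeFn_softNegL2 (p : Lp ℝ 2 μ) : ∀ᵐ x ∂μ, softNegL2 p x = softNeg (p x) :=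
  lipschitzWith_softNeg.coeFn_compLp softNeg_zero p

/-- `∫ G(p)` for the convex primitive `G` of `-softNeg`. -/
noncomputable def energy (p : Lp ℝ 2 μ) : ℝ := ∫ x, softNegEnergy (p x) ∂μ

theorem integrable_softNegEnergy (p : Lp ℝ 2 μ) : Integrable (fun x => softNegEnergy (p x)) μ :=
  (Lp.memLp p).integrable_sq.mono' (continuous_softNegEnergy.comp_aestronglyMeasurable
    (Lp.aestronglyMeasurable p)) (ae_of_all _ fun x => abs_softNegEnergy_le (p x))

theorem energy_eq_zero {p : Lp ℝ 2 μ} (hp : ∀ᵐ x ∂μ, 0 ≤ p x) : energy p = 0 := by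
  refine integral_eq_zero_of_ae ?_
  filter_upwards [hp] with x hx using softNegEnergy_of_nonneg _ hx

theorem nonneg_of_energy_nonpos {p : Lp ℝ 2 μ} (hp : energy p ≤ 0) : ∀ᵐ x ∂μ, 0 ≤ p x := by
  have h0 : energy p = 0 := hp.antisymm (integral_nonneg fun x => softNegEnergy_nonneg _)
  have h := (integral_eq_zero_iff_of_nonneg (fun x => softNegEnergy_nonneg (p x))
    (integrable_softNegEnergy p)).1 h0
  filter_upwards [h] with x hx
  by_contra! hneg
  exact (softNegEnergy_pos _ hneg).ne' hx

theorem abs_energy_taylor_le (p q : Lp ℝ 2 μ) :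
    |energy q - energy p + inner ℝ (softNegL2 p) (q - p)| ≤ ‖q - p‖ ^ 2 := by
  have i1 := L2.integrable_inner (𝕜 := ℝ) (softNegL2 p) (q - p)
  have i2 := (integrable_softNegEnergy q).sub (integrable_softNegEnergy p)
  have e : energy q - energy p + inner ℝ (softNegL2 p) (q - p) =
      ∫ x, (softNegEnergy (q x) - softNegEnergy (p x) + inner ℝ (softNegL2 p x) ((q - p) x)) ∂μ := by
    rw [L2.inner_def]
    have h := integral_add i2 i1
    simp only [Pi.sub_apply] at h
    rw [h, integral_sub (integrable_softNegEnergy q) (integrable_softNegEnergy p)]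
    rfl
  rw [e, ← real_inner_self_eq_norm_sq, L2.inner_def]
  rw [← Real.norm_eq_abs]
  refine norm_integral_le_of_norm_le (L2.integrable_inner (𝕜 := ℝ) (q - p) (q - p)) ?_
  filter_upwards [Lp.coeFn_sub q p, coeFn_softNegL2 p] with x h1 h2
  rw [h1, h2, Pi.sub_apply, real_inner_self_eq_norm_sq, Real.norm_eq_abs, Real.norm_eq_abs, sq_abs]
  refine le_of_eq_of_le (congrArg _ ?_) (abs_softNegEnergy_taylor_le (p x) (q x))
  simp [mul_comm]

/-- The Taylor remainder is quadratic in the L² norm, so it has derivative zero at `p`. -/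
theorem hasFDerivAt_energy (p : Lp ℝ 2 μ) :
    HasFDerivAt energy (-(innerSL ℝ (softNegL2 p))) p := by
  have h1 : HasFDerivAt (fun q => energy q - energy p + inner ℝ (softNegL2 p) (q - p))
      (0 : Lp ℝ 2 μ →L[ℝ] ℝ) p := by
    refine Asymptotics.IsBigO.hasFDerivAt (n := 2) (Asymptotics.IsBigO.of_bound 1
      (Eventually.of_forall fun q => ?_)) one_lt_two
    simpa using abs_energy_taylor_le p q
  have h2 : HasFDerivAt (fun q => innerSL ℝ (softNegL2 p) (q - p)) (innerSL ℝ (softNegL2 p)) p := by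
    exact (innerSL ℝ (softNegL2 p)).hasFDerivAt.comp p ((hasFDerivAt_id p).sub_const p)
  have h3 := (h1.sub h2).add_const (energy p)
  rw [zero_sub] at h3
  refine h3.congr_of_eventuallyEq (Eventually.of_forall fun q => ?_)
  simp

theorem hasDerivAt_energy_comp {γ : ℝ → Lp ℝ 2 μ} {γ' : Lp ℝ 2 μ} {t : ℝ}
    (h : HasDerivAt γ γ' t) :
    HasDerivAt (fun t => energy (γ t)) (-inner ℝ (softNegL2 (γ t)) γ') t := by
  have h1 := (hasFDerivAt_energy (γ t)).comp_hasDerivAt t h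
  exact h1

theorem continuous_energy : Continuous (energy : Lp ℝ 2 μ → ℝ) :=
  continuous_iff_continuousAt.2 fun p => (hasFDerivAt_energy p).continuousAt

end Energy

/-- By the chain rule the gradient of `softNeg(U)` is `-negSlope(U) ∇U`, so the integrand is
`-negSlope(U) |∇U|²`. -/
theorem exists_softNeg_mem_H1 (hΩ : IsOpen Ω) (U : H1 Ω) :
    ∃ V : H1 Ω, toL2 V = softNegL2 (toL2 U) ∧
      ∫ x in Ω, inner ℝ (grad U x) (grad V x) ≤ 0 := by
  have hs : AEStronglyMeasurable (fun x => deriv softNeg (toL2 U x)) (volume.restrict Ω) :=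
    (contDiff_softNeg.continuous_deriv le_rfl).comp_aestronglyMeasurable
      (Lp.aestronglyMeasurable _)
  have hm : MemLp (fun x => deriv softNeg (toL2 U x) • grad U x) 2 (volume.restrict Ω) := by
    refine (Lp.memLp (grad U)).of_le (hs.smul (Lp.aestronglyMeasurable (grad U)))
      (ae_of_all _ fun x => ?_)
    rw [norm_smul]
    exact mul_le_of_le_one_left (norm_nonneg _) (abs_deriv_softNeg_le _)
  have hU : IsWeakGradient (toL2 U) (grad U) := U.2
  refine ⟨⟨WithLp.toLp 2 (softNegL2 (toL2 U), hm.toLp _), hU.comp hΩ contDiff_softNeg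
    abs_deriv_softNeg_le (coeFn_softNegL2 _) hm.coeFn_toLp⟩, rfl, integral_nonpos_of_ae ?_⟩
  filter_upwards [hm.coeFn_toLp] with x hx
  change inner ℝ (grad U x) (hm.toLp _ x) ≤ 0
  rw [hx, real_inner_smul_right, deriv_softNeg]
  exact mul_nonpos_of_nonpos_of_nonneg (neg_nonpos.2 (negSlope_nonneg _)) real_inner_self_nonneg

/-! ### The weak formulation mollified in time. -/

theorem integrable_continuous_smul {F : Type*} [NormedAddCommGroup F] [NormedSpace ℝ F]
    {μ : Measure ℝ} {c : ℝ → ℝ} (hc : Continuous c) (hs : HasCompactSupport c) {g : ℝ → F}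
    (hg : Integrable g μ) : Integrable (fun s => c s • g s) μ := by
  obtain ⟨C, hC⟩ := hs.exists_bound_of_continuous hc
  exact hg.bdd_smul C hc.aestronglyMeasurable (ae_of_all _ hC)

theorem clm_integral_smul_indicator {F : Type*} [NormedAddCommGroup F] [NormedSpace ℝ F]
    [CompleteSpace F] {I : Set ℝ} (hI : MeasurableSet I) {c : ℝ → ℝ} (hc : Continuous c)
    (hs : HasCompactSupport c) {u : ℝ → F} (hu : IntegrableOn u I) (L : F →L[ℝ] ℝ) :
    L (∫ s, c s • I.indicator u s) = ∫ s in I, c s * L (u s) := by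
  have h : (fun s => c s • I.indicator u s) = I.indicator fun s => c s • u s :=
    (indicator_smul I c u).symm
  rw [h, integral_indicator hI, ← L.integral_comp_comm (integrable_continuous_smul hc hs hu)]
  simp

section GelfandTriple

variable {V H K : Type*} [NormedAddCommGroup V] [NormedSpace ℝ V]
  [NormedAddCommGroup H] [InnerProductSpace ℝ H] [NormedAddCommGroup K] [InnerProductSpace ℝ K]

theorem integral_weakDeriv_apply (j : V →L[ℝ] H) {μ : Measure ℝ} {u : ℝ → V}
    {w : ℝ → StrongDual ℝ V} (hu : Integrable u μ) (hw : Integrable w μ) {c d : ℝ → ℝ}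
    (hc : Continuous c) (kc : HasCompactSupport c) (hd : Continuous d) (kd : HasCompactSupport d)
    (h : ∫ s, d s • (innerSL ℝ (j (u s))).comp j ∂μ = - ∫ s, c s • w s ∂μ) (v : V) :
    ∫ s, d s * inner ℝ (j v) (j (u s)) ∂μ = - ∫ s, c s * w s v ∂μ := by
  have h1 : Integrable (fun s => j (u s)) μ := j.integrable_comp hu
  have h2 : Integrable (fun s => (innerSL ℝ (j (u s))).comp j) μ := by
    refine (h1.norm.mul_const ‖j‖).mono'
      (((innerSL ℝ).continuous.clm_comp continuous_const).comp_aestronglyMeasurable h1.1)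
      (ae_of_all _ fun s => ?_)
    have := ContinuousLinearMap.opNorm_comp_le (innerSL ℝ (j (u s))) j
    rwa [innerSL_apply_norm] at this
  have h3 := congrArg (fun l : StrongDual ℝ V => l v) h
  simp only [neg_apply] at h3
  rw [ContinuousLinearMap.integral_apply (integrable_continuous_smul hd kd h2),
    ContinuousLinearMap.integral_apply (integrable_continuous_smul hc kc hw)] at h3
  refine Eq.trans (integral_congr_ae (ae_of_all _ fun s => ?_)) h3
  simp [real_inner_comm]

/-- The weak inequality `⟨∂ₜu, v⟩ + (∇u, ∇v) ≥ 0`, mollified in time. -/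
theorem inner_deriv_mollify_add_inner_nonneg [CompleteSpace V] (j : V →L[ℝ] H) (D : V →L[ℝ] K)
    {I : Set ℝ} (hI : MeasurableSet I) {u : ℝ → V} {w : ℝ → StrongDual ℝ V}
    (hu : IntegrableOn u I) [IsFiniteMeasure (volume.restrict I)]
    (hw2 : MemLp w 2 (volume.restrict I))
    (hderiv : ∀ φ : ℝ → ℝ, ContDiff ℝ ∞ φ → HasCompactSupport φ → tsupport φ ⊆ I →
      ∫ t in I, deriv φ t • (innerSL ℝ (j (u t))).comp j = - ∫ t in I, φ t • w t)
    {v : V} (hv : ∀ φ : ℝ → ℝ, ContDiff ℝ ∞ φ → HasCompactSupport φ → (∀ t, 0 ≤ φ t) →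
      0 ≤ ∫ t in I, φ t * (w t v + inner ℝ (D v) (D (u t))))
    {i : ℕ} {t : ℝ} (ht : Metric.closedBall t (shrinkingBump ℝ i).rOut ⊆ I) :
    0 ≤ inner ℝ (j v) (j (deriv (mollify volume (I.indicator u) i) t)) +
      inner ℝ (D v) (D (mollify volume (I.indicator u) i t)) := by
  set ρ : ℝ → ℝ := (shrinkingBump ℝ i).normed volume with hρ
  have hd : ContDiff ℝ ∞ ρ := (shrinkingBump ℝ i).contDiff_normed
  have hψ : ContDiff ℝ ∞ fun s => ρ (t - s) := hd.comp (contDiff_const.sub contDiff_id)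
  have hts : tsupport (fun s => ρ (t - s)) ⊆ Metric.closedBall t (shrinkingBump ℝ i).rOut :=
    tsupport_normed_const_sub_subset i t
  have hcs : HasCompactSupport fun s => ρ (t - s) :=
    HasCompactSupport.of_support_subset_isCompact (isCompact_closedBall _ _)
      (subset_closure.trans hts)
  have hψ' : (deriv fun s => ρ (t - s)) = fun s => -deriv ρ (t - s) := by
    funext s; exact deriv_comp_const_sub ..
  have iU : LocallyIntegrable (I.indicator u) :=
    ((integrable_indicator_iff hI).2 hu).locallyIntegrable
  have cd : Continuous (deriv fun s => ρ (t - s)) := hψ.continuous_deriv (by simp)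
  have kd : HasCompactSupport (deriv fun s => ρ (t - s)) := hcs.deriv
  have hw : IntegrableOn w I := hw2.integrable one_le_two
  have weak := integral_weakDeriv_apply j hu hw hψ.continuous hcs cd kd
    (hderiv _ hψ hcs (hts.trans ht)) v
  -- The time derivative falls on the kernel and the definition of the weak derivative transfers it
  -- to `w`; `ht` keeps the kernel supported in `I`.
  have e1 : inner ℝ (j v) (j (deriv (mollify volume (I.indicator u) i) t)) =
      ∫ s in I, ρ (t - s) * w s v := by
    have h1 : deriv (mollify volume (I.indicator u) i) t =
        - ∫ s, deriv (fun s => ρ (t - s)) s • I.indicator u s := by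
      rw [← fderiv_apply_one_eq_deriv, fderiv_mollify_apply iU, ← integral_neg, hψ']
      simp [hρ]
    have h2 := clm_integral_smul_indicator hI cd kd hu ((innerSL ℝ (j v)).comp j)
    simp only [ContinuousLinearMap.comp_apply, innerSL_apply_apply] at h2
    rw [h1, map_neg, inner_neg_right, h2, neg_eq_iff_eq_neg]
    exact weak
  have e2 := clm_integral_smul_indicator hI hψ.continuous hcs hu ((innerSL ℝ (D v)).comp D)
  rw [← mollify_apply] at e2
  simp only [ContinuousLinearMap.comp_apply, innerSL_apply_apply] at e2
  have i1 : Integrable (fun s => ρ (t - s) * w s v) (volume.restrict I) :=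
    integrable_continuous_smul hψ.continuous hcs (hw.apply_continuousLinearMap v)
  have i2 : Integrable (fun s => ρ (t - s) * inner ℝ (D v) (D (u s))) (volume.restrict I) :=
    integrable_continuous_smul hψ.continuous hcs (((innerSL ℝ (D v)).comp D).integrable_comp hu)
  rw [e1, e2, ← integral_add i1 i2]
  simp only [← mul_add]
  exact hv _ hψ hcs fun s => (shrinkingBump ℝ i).nonneg_normed _

end GelfandTriple

theorem integral_inner_grad (U v : H1 Ω) :
    ∫ x in Ω, inner ℝ (grad U x) (grad v x) = inner ℝ (grad v) (grad U) := by
  rw [real_inner_comm, L2.inner_def]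

/-- The weak formulation, mollified in time and tested with a nonnegative `v ∈ V`. -/
theorem mollified_inequality {T : ℝ} {f w : ℝ → StrongDual ℝ (H1 Ω)} {u : ℝ → H1 Ω}
    (hf : IsNonnegDual T f) (hu : MemLp u 2 (volume.restrict (Ioo 0 T)))
    (hw : IsWeakTimeDeriv T u w)
    (heq : ∀ v : H1 Ω, ∀ᵐ t ∂(volume.restrict (Ioo 0 T)),
      w t v + ∫ x in Ω, inner ℝ (grad (u t) x) (grad v x) = f t v)
    {i : ℕ} {t : ℝ} (ht : Metric.closedBall t (shrinkingBump ℝ i).rOut ⊆ Ioo 0 T)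
    {v : H1 Ω} (hv : ∀ᵐ x ∂(volume.restrict Ω), 0 ≤ toL2 v x) :
    0 ≤ inner ℝ (toL2 v) (toL2 (deriv (mollify volume ((Ioo 0 T).indicator u) i) t)) +
      inner ℝ (grad v) (grad (mollify volume ((Ioo 0 T).indicator u) i t)) := by
  refine inner_deriv_mollify_add_inner_nonneg toL2 grad measurableSet_Ioo (w := w)
    (hu.integrable one_le_two) hw.memLp hw.integral_eq ?_ ht
  intro φ hφ hc h0
  -- The positivity of `f` is needed only for products `φ(s) v`. The null set in `heq` depends on
  -- `v`, which is harmless under the integral.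
  have key := hf (fun s => φ s • v) ?_ ⟨fun s => φ s • toL2 v, ?_, ?_⟩ ?_
  · refine key.trans_eq (integral_congr_ae ?_)
    filter_upwards [heq v] with s hs
    rw [map_smul, ← hs, smul_eq_mul, integral_inner_grad]
  · exact (hφ.continuous.smul continuous_const).memLp_of_hasCompactSupport hc.smul_right
  · exact (hφ.continuous.smul continuous_const).continuousOn
  · exact ae_of_all _ fun s => map_smul _ _ _
  · refine ae_of_all _ fun s => ?_
    rw [map_smul]
    filter_upwards [hv, Lp.coeFn_smul (φ s) (toL2 v)] with x hx h1
    rw [h1]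
    exact mul_nonneg (h0 s) hx

/-! ### Decay of the energy and conclusion. -/

theorem antitoneOn_energy_mollify (hΩ : IsOpen Ω) {T : ℝ} {f w : ℝ → StrongDual ℝ (H1 Ω)}
    {u : ℝ → H1 Ω} (hf : IsNonnegDual T f) (hu : MemLp u 2 (volume.restrict (Ioo 0 T)))
    (hw : IsWeakTimeDeriv T u w)
    (heq : ∀ v : H1 Ω, ∀ᵐ t ∂(volume.restrict (Ioo 0 T)),
      w t v + ∫ x in Ω, inner ℝ (grad (u t) x) (grad v x) = f t v) (i : ℕ) :
    AntitoneOn (fun t => energy (toL2 (mollify volume ((Ioo 0 T).indicator u) i t)))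
      (Ioo (shrinkingBump ℝ i).rOut (T - (shrinkingBump ℝ i).rOut)) := by
  set m := mollify volume ((Ioo 0 T).indicator u) i with hm
  have iU : LocallyIntegrable ((Ioo 0 T).indicator u) :=
    ((integrable_indicator_iff measurableSet_Ioo).2 (hu.integrable one_le_two)).locallyIntegrable
  have hm' : ∀ t, HasDerivAt (fun t => toL2 (m t)) (toL2 (deriv m t)) t := fun t =>
    (toL2 : H1 Ω →L[ℝ] L2 Ω).hasFDerivAt.comp_hasDerivAt t
      ((contDiff_mollify iU i).differentiable one_ne_zero t).hasDerivAt
  have hd : ∀ t, HasDerivAt (fun t => energy (toL2 (m t)))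
      (-inner ℝ (softNegL2 (toL2 (m t))) (toL2 (deriv m t))) t := fun t =>
    hasDerivAt_energy_comp (hm' t)
  refine antitoneOn_of_deriv_nonpos (convex_Ioo _ _)
    (fun t _ => (hd t).continuousAt.continuousWithinAt)
    (fun t _ => (hd t).differentiableAt.differentiableWithinAt) fun t ht => ?_
  rw [interior_Ioo] at ht
  -- The mollified inequality holds at every such `t` for every nonnegative `v`, so the test
  -- function may depend on `t`.
  obtain ⟨V, hV, hneg⟩ := exists_softNeg_mem_H1 hΩ (m t)
  have h := mollified_inequality (v := V) (t := t) hf hu hw heq (i := i) ?_ ?_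
  · rw [integral_inner_grad] at hneg
    rw [(hd t).deriv, ← hV]
    linarith
  · rw [Real.closedBall_eq_Icc]
    exact fun s hs => ⟨by linarith [hs.1, ht.1], by linarith [hs.2, ht.2]⟩
  · rw [hV]
    filter_upwards [coeFn_softNegL2 (toL2 (m t))] with x hx
    rw [hx]
    exact softNeg_nonneg _

/-- On the set `S` of convergence of the mollifications, monotonicity passes to the limit by
continuity of `energy`; no continuous representative of `u` is needed. -/
theorem energy_le_of_ae (hΩ : IsOpen Ω) {T : ℝ} {f w : ℝ → StrongDual ℝ (H1 Ω)}
    {u : ℝ → H1 Ω} (hf : IsNonnegDual T f) (hu : MemLp u 2 (volume.restrict (Ioo 0 T)))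
    (hw : IsWeakTimeDeriv T u w)
    (heq : ∀ v : H1 Ω, ∀ᵐ t ∂(volume.restrict (Ioo 0 T)),
      w t v + ∫ x in Ω, inner ℝ (grad (u t) x) (grad v x) = f t v) :
    ∃ S : Set ℝ, S ∈ ae (volume : Measure ℝ) ∧ ∀ s ∈ S ∩ Ioo 0 T, ∀ t ∈ S ∩ Ioo 0 T, s ≤ t →
      energy (toL2 (u t)) ≤ energy (toL2 (u s)) := by
  have iU : LocallyIntegrable ((Ioo 0 T).indicator u) :=
    ((integrable_indicator_iff measurableSet_Ioo).2 (hu.integrable one_le_two)).locallyIntegrable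
  refine ⟨_, ae_tendsto_mollify iU, fun s hs t ht hst => ?_⟩
  have lim : ∀ r ∈ Ioo 0 T, Tendsto (fun i => mollify volume ((Ioo 0 T).indicator u) i r) atTop
      (𝓝 ((Ioo 0 T).indicator u r)) → Tendsto (fun i => energy (toL2
        (mollify volume ((Ioo 0 T).indicator u) i r))) atTop (𝓝 (energy (toL2 (u r)))) := by
    intro r hr h
    rw [indicator_of_mem hr] at h
    exact ((continuous_energy.comp toL2.continuous).tendsto _).comp h
  refine le_of_tendsto_of_tendsto (lim t ht.2 ht.1) (lim s hs.2 hs.1) ?_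
  have hr := tendsto_rOut_shrinkingBump ℝ
  filter_upwards [hr.eventually_lt_const hs.2.1,
    hr.eventually_lt_const (sub_pos.2 ht.2.2)] with i h1 h2
  exact antitoneOn_energy_mollify hΩ hf hu hw heq i ⟨h1, by linarith⟩
    ⟨by linarith, by linarith⟩ hst

/-- A conull set meets every interval `(0, ε)`. Nontriviality of this filter allows inequalities to
pass to the limit defining the initial value. -/
instance : (𝓝[>] (0 : ℝ) ⊓ ae volume).NeBot := by
  refine inf_neBot_iff.2 fun A hA S hS => ?_
  obtain ⟨ε, hε, hεA⟩ := mem_nhdsGT_iff_exists_Ioo_subset.1 hA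
  have h1 : volume (Ioo 0 ε ∩ S) ≠ 0 := by
    rw [measure_inter_conull' (by simpa using measure_mono_null (sdiff_subset_compl _ _) hS)]
    simpa using hε
  exact (nonempty_of_measure_ne_zero h1).mono (inter_subset_inter_left _ hεA)

end NeumannHeat

theorem mainTheorem3 {n : ℕ} {Ω : Set (EuclideanSpace ℝ (Fin n))} (hΩ : IsOpen Ω)
    (hΩc : IsConnected Ω) {T : ℝ} (hT : 0 < T)
    (f : ℝ → StrongDual ℝ (NeumannHeat.H1 Ω)) (hf : NeumannHeat.MemL1L2AddL2Dual T f)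
    (hf_nonneg : NeumannHeat.IsNonnegDual T f)
    (u₀ : NeumannHeat.L2 Ω) (hu₀ : ∀ᵐ x ∂(volume.restrict Ω), 0 ≤ u₀ x)
    (u : ℝ → NeumannHeat.H1 Ω) (hu : NeumannHeat.IsWeakSolution T f u₀ u) :
    -- for almost every `t`, `u(t, ·) ≥ 0` almost everywhere on `Ω`
    NeumannHeat.IsNonneg T u ∧
    -- every measurable representative of `u` on `(0, T) × Ω` is nonnegative almost everywhere
    ∀ U : ℝ × EuclideanSpace ℝ (Fin n) → ℝ,
      AEStronglyMeasurable U ((volume.restrict (Ioo 0 T)).prod (volume.restrict Ω)) →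
      (∀ᵐ t ∂(volume.restrict (Ioo 0 T)),
        (fun x => U (t, x)) =ᵐ[volume.restrict Ω] NeumannHeat.toL2 (u t)) →
      ∀ᵐ p ∂((volume.restrict (Ioo 0 T)).prod (volume.restrict Ω)), 0 ≤ U p := by
  obtain ⟨hu2, w, hw, heq, hinit⟩ := hu
  obtain ⟨S, hS, hmono⟩ := NeumannHeat.energy_le_of_ae hΩ hf_nonneg hu2 hw heq
  have nonneg : NeumannHeat.IsNonneg T u := by
    refine (ae_restrict_iff' measurableSet_Ioo).2 (mem_of_superset hS fun t htS ht => ?_)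
    refine NeumannHeat.nonneg_of_energy_nonpos ?_
    rw [← NeumannHeat.energy_eq_zero hu₀]
    -- The earlier time `s` tends to 0 within `S`, with `t` fixed.
    refine ge_of_tendsto ((NeumannHeat.continuous_energy.tendsto _).comp hinit) ?_
    filter_upwards [mem_inf_of_left (Ioo_mem_nhdsGT ht.1), mem_inf_of_right hS] with s hs hsS
    exact hmono s ⟨hsS, hs.1, hs.2.trans ht.2⟩ t ⟨htS, ht⟩ hs.2.le
  refine ⟨nonneg, fun U hU hUu => ?_⟩
  -- A strongly measurable version makes the set where it is nonnegative measurable, as needed to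
  -- pass from slices to the product.
  have hmk := hU.ae_eq_mk
  have h1 : ∀ᵐ p ∂((volume.restrict (Ioo 0 T)).prod (volume.restrict Ω)), 0 ≤ hU.mk U p := by
    rw [Measure.ae_prod_iff_ae_ae
      (measurableSet_le measurable_const hU.stronglyMeasurable_mk.measurable)]
    filter_upwards [nonneg, hUu, Measure.ae_ae_of_ae_prod hmk] with t a1 a2 a3
    filter_upwards [a1, a2, a3] with x b1 b2 b3
    rw [← b3, b2]
    exact b1
  filter_upwards [hmk, h1] with p a1 a2
  rw [a1]
  exact a2
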